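/- Let $n$ be a positive multiple of $3$. The three-bundle configuration $L^3(n)$ consists of the $n$ axis-parallel lines in $\mathbb{R}^3$ $$\{(0,i,i)+\lambda(1,0,0):\lambda\in\mathbb{R}\},\qquad \{(i,0,\tfrac{2n}{3}+1-i)+\lambda(0,1,0):\lambda\in\mathbb{R}\}\qquad (1\le i\le \tfrac n3),$$ $$\{(i,i,0)+\lambda(0,0,1):\lambda\in\mathbb{R}\}\qquad (\tfrac n3< i\le \tfrac{2n}{3}),$$ each of them translated by a small vector, where the translations are chosen such that no plane contains three or more of the resulting lines. For a finite set $L$ of lines in $\mathbb{R}^3$ let $g(L)$ be the minimum integer $k$ for which there is a set $H$ of three planes such that every open cell of the arrangement of $H$ (every connected component of the complement of the union of the three planes) meets at most $k$ lines of $L$; the planes of $H$ are arbitrary and need not be parallel to any coordinate axis. Let $g_{\|}(L)$ be the same minimum taken over sets $H$ of three axis-parallel planes (planes parallel to two of the coordinate axes), and $g_{\perp}(L)$ the same minimum over sets $H$ of three mutually orthogonal axis-parallel planes. Theorem. For every $n$ divisible by $3$ there is a $\delta>0$ such that for all translations of length less than $\delta$ for which no plane contains three of the lines, the resulting configuration $L^3(n)$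 satisfies: - if $n\ge 9$, then $g_{\perp}(L^3(n))=g_{\|}(L^3(n))=g(L^3(n))=\frac n3-1$; - if $n=6$, then $g_{\perp}(L^3(n))=g_{\|}(L^3(n))=1$ and $g(L^3(n))=0$; - if $n=3$, then $g_{\perp}(L^3(n))=g_{\|}(L^3(n))=g(L^3(n))=0$. -/

import Mathlib

/-- Euclidean three-space. -/
abbrev Space : Type := EuclideanSpace ℝ (Fin 3)

/-- The unit vector along the coordinate axis `a` (`0, 1, 2` stand for `x, y, z`). -/
noncomputable def axisVec (a : Fin 3) : Space := EuclideanSpace.single a 1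

/-- The line through `p` parallel to the coordinate axis `a`. -/
noncomputable def axisLine (a : Fin 3) (p : Space) : AffineSubspace ℝ Space :=
  AffineSubspace.mk' p (Submodule.span ℝ {axisVec a})

/-- A plane: an affine subspace of dimension two (in particular it is nonempty). -/
def IsPlane (h : AffineSubspace ℝ Space) : Prop :=
  Module.finrank ℝ h.direction = 2

/-- A plane is axis-parallel if it is parallel to two of the coordinate axes. -/
def IsAxisParallel (h : AffineSubspace ℝ Space) : Prop :=
  ∃ a b : Fin 3, a ≠ b ∧ axisVec a ∈ h.direction ∧ axisVec b ∈ h.direction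

/-- Two planes are orthogonal if their normal lines are. -/
def OrthogonalPlanes (h h' : AffineSubspace ℝ Space) : Prop :=
  h.directionᗮ ⟂ h'.directionᗮ

/-- `C` is an open cell of the arrangement of the planes in `H`: the set of all points that lie
strictly on the same side of every plane of `H` as some point `p` lying on none of them. -/
def IsOpenCell (H : Set (AffineSubspace ℝ Space)) (C : Set Space) : Prop :=
  ∃ p : Space, (∀ h ∈ H, p ∉ h) ∧ C = {q | ∀ h ∈ H, h.SSameSide p q}

/-- Every open cell of the arrangement of `H` meets at most `k` lines of `L`. -/
def CellsMeetAtMost (H L : Set (AffineSubspace ℝ Space)) (k : ℕ) : Prop :=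
  ∀ C : Set Space, IsOpenCell H C →
    {l : AffineSubspace ℝ Space | l ∈ L ∧ ((l : Set Space) ∩ C).Nonempty}.encard ≤ k

/-- `H` consists of three (distinct) planes. -/
def IsPlaneTriple (H : Set (AffineSubspace ℝ Space)) : Prop :=
  H.ncard = 3 ∧ ∀ h ∈ H, IsPlane h

/-- `H` consists of three axis-parallel planes. -/
def IsAxisParallelTriple (H : Set (AffineSubspace ℝ Space)) : Prop :=
  IsPlaneTriple H ∧ ∀ h ∈ H, IsAxisParallel h

/-- `H` consists of three mutually orthogonal axis-parallel planes. -/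
def IsOrthogonalAxisParallelTriple (H : Set (AffineSubspace ℝ Space)) : Prop :=
  IsAxisParallelTriple H ∧ H.Pairwise OrthogonalPlanes

/-- `g(L) = k`, for arbitrary splitting planes: `k` is the minimum number such that for some three
planes every open cell of their arrangement meets at most `k` lines of `L`. -/
def GEq (L : Set (AffineSubspace ℝ Space)) (k : ℕ) : Prop :=
  IsLeast {j : ℕ | ∃ H, IsPlaneTriple H ∧ CellsMeetAtMost H L j} k

/-- `g_∥(L) = k`: as `GEq`, for axis-parallel splitting planes. -/
def GParEq (L : Set (AffineSubspace ℝ Space)) (k : ℕ) : Prop :=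
  IsLeast {j : ℕ | ∃ H, IsAxisParallelTriple H ∧ CellsMeetAtMost H L j} k

/-- `g_⊥(L) = k`: as `GEq`, for mutually orthogonal axis-parallel splitting planes. -/
def GPerpEq (L : Set (AffineSubspace ℝ Space)) (k : ℕ) : Prop :=
  IsLeast {j : ℕ | ∃ H, IsOrthogonalAxisParallelTriple H ∧ CellsMeetAtMost H L j} k

/-- The bundle of lines parallel to the `x`-axis, the `i`-th line being shifted by `u i`. -/
def bundleX (m : ℕ) (u : ℕ → Space) : Set (AffineSubspace ℝ Space) :=
  {l | ∃ i : ℕ, 1 ≤ i ∧ i ≤ m ∧ l = axisLine 0 (!₂[0, (i : ℝ), (i : ℝ)] + u i)}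

/-- The bundle of lines parallel to the `y`-axis, the `i`-th line being shifted by `v i`. -/
def bundleY (m : ℕ) (v : ℕ → Space) : Set (AffineSubspace ℝ Space) :=
  {l | ∃ i : ℕ, 1 ≤ i ∧ i ≤ m ∧ l = axisLine 1 (!₂[(i : ℝ), 0, 2 * (m : ℝ) + 1 - (i : ℝ)] + v i)}

/-- The bundle of lines parallel to the `z`-axis, the `i`-th line being shifted by `w i`. -/
def bundleZ (m : ℕ) (w : ℕ → Space) : Set (AffineSubspace ℝ Space) :=
  {l | ∃ i : ℕ, m < i ∧ i ≤ 2 * m ∧ l = axisLine 2 (!₂[(i : ℝ), (i : ℝ), 0] + w i)}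

/-- The three-bundle configuration on `n` lines (`n` divisible by three), with shifts `u, v, w`. -/
def threeBundles (n : ℕ) (u v w : ℕ → Space) : Set (AffineSubspace ℝ Space) :=
  bundleX (n / 3) u ∪ bundleY (n / 3) v ∪ bundleZ (n / 3) w

/-- No plane contains three or more lines of `L`. -/
def NoThreeCoplanar (L : Set (AffineSubspace ℝ Space)) : Prop :=
  ∀ h : AffineSubspace ℝ Space, IsPlane h →
    {l : AffineSubspace ℝ Space | l ∈ L ∧ l ≤ h}.encard ≤ 2

/-! Let m = n/3.

Lower bound: suppose every cell meets at most k < m lines. Far out along a bundle, a plane not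
parallel to it has all its lines on one side. Hence each bundle must be split by a plane parallel to
it, since otherwise its m lines would share a cell (`CellBound.exists_splits`). A plane parallel to
two bundles fixes the third coordinate, in which these bundles are separated, so no plane splits two
bundles (`Splits.unique`). Thus the planes correspond to the bundles, and each plane cuts its own
bundle into two halves, apart from the lines lying on it.

Which halves share a cell at infinity depends only on the signs of the coordinates of the three
normals. A finite check (`sign_cases`) shows that few cells at infinity always cover all the halves
of two or three bundles. A plane contains at most two lines of its bundle, and at most one unless
its normal has the signs forced by the diagonal stacking. For m ≥ 3, counting the lines in these
cells gives k ≥ m - 1 (`CellBound.le_of_splits`).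

Upper bound: one axis-orthogonal plane through an extreme line of each bundle separates the bundles
from each other and absorbs one line of each (`exists_cellsMeetAtMost`). For m = 2, three slanted
planes, each through both lines of a bundle, absorb everything. An axis-parallel plane absorbs at
most one of the six lines, so three of them do not suffice. -/

/-! ### Planes as zero sets of affine functionals -/

/-- The affine functional with gradient `ν` and constant term `-c`. -/
noncomputable def height (ν : Space) (c : ℝ) (q : Space) : ℝ := inner ℝ ν q - c

/-- The plane on which the functional `height ν c` vanishes. -/
noncomputable def levelPlane (ν : Space) (c : ℝ) : AffineSubspace ℝ Space :=
  AffineSubspace.mk' ((c / inner ℝ ν ν) • ν) (Submodule.span ℝ {ν})ᗮ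

theorem height_eq (ν : Space) (c : ℝ) (q : Space) :
    height ν c q = ν 0 * q 0 + ν 1 * q 1 + ν 2 * q 2 - c := by
  simp [height, PiLp.inner_apply, Fin.sum_univ_three, mul_comm]

theorem inner_self_pos_of_ne {ν : Space} (hν : ν ≠ 0) : 0 < (inner ℝ ν ν : ℝ) :=
  real_inner_self_pos.2 hν

theorem mem_levelPlane {ν : Space} (hν : ν ≠ 0) {c : ℝ} {q : Space} :
    q ∈ levelPlane ν c ↔ height ν c q = 0 := by
  have h := (inner_self_pos_of_ne hν).ne'
  rw [levelPlane, AffineSubspace.mem_mk', Submodule.mem_orthogonal_singleton_iff_inner_right,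
    vsub_eq_sub, inner_sub_right, inner_smul_right, div_mul_cancel₀ _ h, height]

theorem direction_levelPlane (ν : Space) (c : ℝ) :
    (levelPlane ν c).direction = (Submodule.span ℝ {ν})ᗮ :=
  AffineSubspace.direction_mk' _ _

theorem mem_direction_levelPlane {ν : Space} {c : ℝ} {a : Fin 3} :
    axisVec a ∈ (levelPlane ν c).direction ↔ ν a = 0 := by
  rw [direction_levelPlane, Submodule.mem_orthogonal_singleton_iff_inner_right, axisVec,
    EuclideanSpace.inner_single_right]
  simp

theorem isPlane_levelPlane {ν : Space} (hν : ν ≠ 0) (c : ℝ) : IsPlane (levelPlane ν c) := by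
  have : Fact (Module.finrank ℝ Space = 2 + 1) := ⟨by simp [Space]⟩
  rw [IsPlane, direction_levelPlane]
  exact Submodule.finrank_orthogonal_span_singleton hν

theorem IsPlane.exists_eq_levelPlane {h : AffineSubspace ℝ Space} (hh : IsPlane h) :
    ∃ ν : Space, ∃ c : ℝ, ν ≠ 0 ∧ h = levelPlane ν c := by
  have hne : (h : Set Space).Nonempty := by
    rw [AffineSubspace.nonempty_iff_ne_bot]
    rintro rfl
    rw [IsPlane, AffineSubspace.direction_bot, finrank_bot] at hh
    omega
  obtain ⟨p, hp⟩ := hne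
  have h3 : Module.finrank ℝ Space = 3 := by simp [Space]
  have h1 : Module.finrank ℝ h.directionᗮ = 1 := by
    have := Submodule.finrank_add_finrank_orthogonal h.direction
    rw [h3] at this
    unfold IsPlane at hh
    omega
  obtain ⟨⟨ν, hν⟩, hν0, hspan⟩ := finrank_eq_one_iff'.1 h1
  have hν0' : ν ≠ 0 := fun h0 => hν0 (by ext1; exact h0)
  have hs : Submodule.span ℝ {ν} = h.directionᗮ := by
    apply le_antisymm
    · rw [Submodule.span_le, Set.singleton_subset_iff]
      exact hν
    · intro x hx
      obtain ⟨r, hr⟩ := hspan ⟨x, hx⟩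
      exact Submodule.mem_span_singleton.2 ⟨r, congrArg Subtype.val hr⟩
  refine ⟨ν, inner ℝ ν p, hν0', ?_⟩
  refine AffineSubspace.ext_of_direction_eq ?_ ⟨p, hp, ?_⟩
  · rw [direction_levelPlane, hs, Submodule.orthogonal_orthogonal]
  · exact (mem_levelPlane hν0').2 (by simp [height])

theorem height_add_smul (ν : Space) (c t : ℝ) (q e : Space) :
    height ν c (q + t • e) = height ν c q + t * inner ℝ ν e := by
  simp only [height, inner_add_right, inner_smul_right]
  ring

/-- Taking inner products with `ν` turns a common ray from the plane into proportional heights.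
Conversely, the displacements of `p` and `q` from the feet of their perpendiculars are multiples of
`ν` whose factors have the signs of the heights. -/
theorem sSameSide_levelPlane_iff {ν : Space} (hν : ν ≠ 0) {c : ℝ} {p q : Space}
    (hp : height ν c p ≠ 0) :
    (levelPlane ν c).SSameSide p q ↔
      SignType.sign (height ν c p) = SignType.sign (height ν c q) := by
  have hpos := inner_self_pos_of_ne hν
  constructor
  · rintro ⟨⟨p₁, hp₁, q₁, hq₁, hray⟩, -, hq⟩
    rw [mem_levelPlane hν] at hp₁ hq₁ hq
    have e1 : height ν c p = inner ℝ ν (p - p₁) := by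
      rw [inner_sub_right]; unfold height at *; linarith
    have e2 : height ν c q = inner ℝ ν (q - q₁) := by
      rw [inner_sub_right]; unfold height at *; linarith
    rcases hray with h0 | h0 | ⟨r₁, r₂, hr₁, hr₂, hr⟩
    · rw [vsub_eq_sub] at h0
      rw [h0, inner_zero_right] at e1
      exact absurd e1 hp
    · rw [vsub_eq_sub] at h0
      rw [h0, inner_zero_right] at e2
      exact absurd e2 hq
    · have h1 : r₁ * height ν c p = r₂ * height ν c q := by
        rw [e1, e2, ← inner_smul_right, ← inner_smul_right]
        exact congrArg _ hr
      have h2 := congrArg SignType.sign h1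
      rwa [sign_mul, sign_mul, sign_pos hr₁, sign_pos hr₂, one_mul, one_mul] at h2
  · intro hs
    have hq : height ν c q ≠ 0 := by
      rw [← sign_ne_zero, ← hs]; exact sign_ne_zero.2 hp
    have key : ∀ x : Space, x - (height ν c x / inner ℝ ν ν) • ν ∈ levelPlane ν c := by
      intro x
      rw [mem_levelPlane hν, sub_eq_add_neg, ← neg_smul, height_add_smul, neg_mul,
        div_mul_cancel₀ _ hpos.ne', add_neg_cancel]
    refine ⟨⟨_, key p, _, key q, ?_⟩, ?_, ?_⟩
    · rw [vsub_eq_sub, vsub_eq_sub, sub_sub_cancel, sub_sub_cancel]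
      rcases lt_or_gt_of_ne hp with h | h
      · rw [sign_neg h, eq_comm, sign_eq_neg_one_iff] at hs
        refine Or.inr (Or.inr ⟨-height ν c q, -height ν c p, by linarith, by linarith, ?_⟩)
        rw [smul_smul, smul_smul]
        congr 1
        ring
      · rw [sign_pos h, eq_comm, sign_eq_one_iff] at hs
        refine Or.inr (Or.inr ⟨height ν c q, height ν c p, by linarith, by linarith, ?_⟩)
        rw [smul_smul, smul_smul]
        congr 1
        ring
    · rwa [mem_levelPlane hν]
    · rwa [mem_levelPlane hν]

/-! ### Axis-parallel lines and their ends -/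

theorem mem_axisLine {a : Fin 3} {p q : Space} :
    q ∈ axisLine a p ↔ ∃ t : ℝ, q = p + t • axisVec a := by
  rw [axisLine, AffineSubspace.mem_mk', Submodule.mem_span_singleton]
  refine exists_congr fun t => ?_
  rw [vsub_eq_sub, eq_sub_iff_add_eq, add_comm, eq_comm]

theorem apply_eq_of_mem_axisLine {a b : Fin 3} {p q : Space} (h : q ∈ axisLine a p)
    (hb : b ≠ a) : q b = p b := by
  obtain ⟨t, rfl⟩ := mem_axisLine.1 h
  simp [axisVec, hb]

theorem height_on_axisLine (ν : Space) (c t : ℝ) (p : Space) (a : Fin 3) :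
    height ν c (p + t • axisVec a) = height ν c p + t * ν a := by
  rw [height_add_smul, axisVec, EuclideanSpace.inner_single_right]
  simp

theorem axisLine_le_levelPlane {ν : Space} (hν : ν ≠ 0) {c : ℝ} {p : Space} {a : Fin 3} :
    axisLine a p ≤ levelPlane ν c ↔ ν a = 0 ∧ height ν c p = 0 := by
  constructor
  · intro h
    have h0 := (mem_levelPlane hν).1 (h (mem_axisLine.2 ⟨0, rfl⟩))
    have h1 := (mem_levelPlane hν).1 (h (mem_axisLine.2 ⟨1, rfl⟩))
    rw [height_on_axisLine] at h0 h1
    constructor <;> linarith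
  · rintro ⟨h1, h2⟩ q hq
    obtain ⟨t, rfl⟩ := mem_axisLine.1 hq
    exact (mem_levelPlane hν).2 (by rw [height_on_axisLine, h1, h2]; simp)

/-- Far out along a line, in either direction, every affine functional has the sign of its slope, or
is constant. -/
theorem exists_far_sign (x y : Fin 3 → ℝ) {τ : SignType} (hτ : τ ≠ 0) :
    ∃ t : ℝ, ∀ j, SignType.sign (x j + t * y j) =
      if y j = 0 then SignType.sign (x j) else τ * SignType.sign (y j) := by
  have hev : ∀ j, ∀ᶠ t in Filter.atTop, |x j| < t * |y j| ∨ y j = 0 := by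
    intro j
    by_cases hy : y j = 0
    · simp [hy]
    · filter_upwards [Filter.eventually_gt_atTop (|x j| / |y j|)] with t ht
      exact Or.inl ((div_lt_iff₀ (abs_pos.2 hy)).1 ht)
  obtain ⟨t, ht⟩ := (Filter.eventually_all.2 hev).exists
  refine ⟨(τ : ℝ) * t, fun j => ?_⟩
  split_ifs with hy
  · simp [hy]
  · have h := (ht j).resolve_right hy
    have hx := abs_lt.1 h
    rcases lt_or_gt_of_ne hy with hy' | hy' <;> cases τ
    · exact absurd rfl hτ
    · rw [abs_of_neg hy'] at hx
      rw [sign_neg hy', sign_pos]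
      · rfl
      · simp; nlinarith
    · rw [abs_of_neg hy'] at hx
      rw [sign_neg hy', sign_neg]
      · rfl
      · simp; nlinarith
    · exact absurd rfl hτ
    · rw [abs_of_pos hy'] at hx
      rw [sign_pos hy', sign_neg]
      · rfl
      · simp; nlinarith
    · rw [abs_of_pos hy'] at hx
      rw [sign_pos hy', sign_pos]
      · rfl
      · simp; nlinarith

/-! ### Sign patterns of the normals and cells at infinity -/

/-- The property `p` holds for one of the two nonzero signs. -/
def EitherSign (p : SignType → Prop) : Prop := p 1 ∨ p (-1)

instance (p : SignType → Prop) [DecidablePred p] : Decidable (EitherSign p) :=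
  inferInstanceAs (Decidable (p 1 ∨ p (-1)))

theorem EitherSign.exists {p : SignType → Prop} (h : EitherSign p) : ∃ s, s ≠ 0 ∧ p s :=
  h.elim (fun h => ⟨1, by decide, h⟩) (fun h => ⟨-1, by decide, h⟩)

/-- The sign at infinity, in direction `τ`, of the lines of the bundle `a` with respect to the
plane that splits the bundle `j`; here `E j` is the sign vector of the normal of that plane. -/
def farSign (E : Fin 3 → Fin 3 → SignType) (j a : Fin 3) (τ : SignType) : SignType :=
  if E j a = 0 then (if a < j then -1 else 1) * E j (-(a + j)) else τ * E j a

/-- Some end of the lines of the bundle `a` has, with respect to the planes splitting the other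
bundles, the signs prescribed by `s`. -/
def Reaches (E : Fin 3 → Fin 3 → SignType) (a : Fin 3) (s : Fin 3 → SignType) : Prop :=
  EitherSign fun τ => farSign E (a + 1) a τ = s (a + 1) ∧ farSign E (a + 2) a τ = s (a + 2)

instance (E : Fin 3 → Fin 3 → SignType) (a : Fin 3) (s : Fin 3 → SignType) :
    Decidable (Reaches E a s) :=
  inferInstanceAs (Decidable (EitherSign fun τ =>
    farSign E (a + 1) a τ = s (a + 1) ∧ farSign E (a + 2) a τ = s (a + 2)))

/-- The lines of the bundle `a` with sign `s` and those of the bundle `b` with sign `t` have a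
common cell at infinity. -/
def Meet (E : Fin 3 → Fin 3 → SignType) (a b : Fin 3) (s t : SignType) : Prop :=
  EitherSign fun r =>
    Reaches E a (fun j => if j = a then s else if j = b then t else r) ∧
    Reaches E b (fun j => if j = a then s else if j = b then t else r)

instance (E : Fin 3 → Fin 3 → SignType) (a b : Fin 3) (s t : SignType) :
    Decidable (Meet E a b s t) :=
  inferInstanceAs (Decidable (EitherSign fun r =>
    Reaches E a (fun j => if j = a then s else if j = b then t else r) ∧
    Reaches E b (fun j => if j = a then s else if j = b then t else r)))

/-- Two opposite cells at infinity each contain lines of all three bundles. -/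
def HasCommonCells (E : Fin 3 → Fin 3 → SignType) : Prop :=
  EitherSign fun t => EitherSign fun r =>
    ∀ a, Reaches E a ![1, t, r] ∧ Reaches E a ![-1, -t, -r]

instance (E : Fin 3 → Fin 3 → SignType) : Decidable (HasCommonCells E) :=
  inferInstanceAs (Decidable (EitherSign fun t => EitherSign fun r =>
    ∀ a, Reaches E a ![1, t, r] ∧ Reaches E a ![-1, -t, -r]))

/-- The two halves of the bundle `a` can be paired with the two halves of the bundle `b` so that
paired halves meet in a cell at infinity. -/
def HasPairing (E : Fin 3 → Fin 3 → SignType) (a b : Fin 3) : Prop :=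
  EitherSign fun t => Meet E a b 1 t ∧ Meet E a b (-1) (-t)

instance (E : Fin 3 → Fin 3 → SignType) (a b : Fin 3) : Decidable (HasPairing E a b) :=
  inferInstanceAs (Decidable (EitherSign fun t => Meet E a b 1 t ∧ Meet E a b (-1) (-t)))

/-- The six halves of the three bundles can be paired so that paired halves meet in a cell at
infinity, each two bundles contributing one pair. -/
def HasMatching (E : Fin 3 → Fin 3 → SignType) : Prop :=
  EitherSign fun s => EitherSign fun t => Meet E 0 1 s t ∧
    EitherSign fun r => Meet E 1 2 (-t) r ∧ Meet E 0 2 (-s) (-r)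

instance (E : Fin 3 → Fin 3 → SignType) : Decidable (HasMatching E) :=
  inferInstanceAs (Decidable (EitherSign fun s => EitherSign fun t => Meet E 0 1 s t ∧
    EitherSign fun r => Meet E 1 2 (-t) r ∧ Meet E 0 2 (-s) (-r)))

/-- The sign vector of a normal is compatible with the plane containing two lines of the
bundle `a`. -/
def IsDiagonal (E : Fin 3 → Fin 3 → SignType) (a : Fin 3) : Prop :=
  E a (a + 1) * E a (a + 2) = if a = 1 then 1 else -1

instance (E : Fin 3 → Fin 3 → SignType) (a : Fin 3) : Decidable (IsDiagonal E a) :=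
  inferInstanceAs (Decidable (E a (a + 1) * E a (a + 2) = if a = 1 then 1 else -1))

/-- Finite check over the possible signs of three nonzero normals, each vanishing in the direction
of its own bundle. The side conditions limit the lines lost on the planes: at most three on the two
planes of a pairing and at most five on the three planes of a matching. Common cells tolerate six.
-/
theorem sign_cases : ∀ x₁ x₂ y₀ y₂ z₀ z₁ : SignType,
    ¬(x₁ = 0 ∧ x₂ = 0) → ¬(y₂ = 0 ∧ y₀ = 0) → ¬(z₀ = 0 ∧ z₁ = 0) →
    (∃ a, ¬(IsDiagonal ![![0, x₁, x₂], ![y₀, 0, y₂], ![z₀, z₁, 0]] a ∧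
        IsDiagonal ![![0, x₁, x₂], ![y₀, 0, y₂], ![z₀, z₁, 0]] (a + 1)) ∧
        HasPairing ![![0, x₁, x₂], ![y₀, 0, y₂], ![z₀, z₁, 0]] a (a + 1)) ∨
      ((∃ a, ¬IsDiagonal ![![0, x₁, x₂], ![y₀, 0, y₂], ![z₀, z₁, 0]] a) ∧
        HasMatching ![![0, x₁, x₂], ![y₀, 0, y₂], ![z₀, z₁, 0]]) ∨
      HasCommonCells ![![0, x₁, x₂], ![y₀, 0, y₂], ![z₀, z₁, 0]] := by
  decide +kernel

theorem fin_three_cases (a j : Fin 3) : j = a ∨ j = a + 1 ∨ j = a + 2 := by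
  revert a j
  decide

theorem fin_three_add_one_ne : ∀ a : Fin 3, a + 1 ≠ a := by decide

theorem fin_three_add_two_ne : ∀ a : Fin 3, a + 2 ≠ a := by decide

/-- The three indices sum to zero in `Fin 3`, so `-(a + b)` is the one left over. -/
theorem fin_three_third_ne : ∀ {a b : Fin 3}, a ≠ b → -(a + b) ≠ a ∧ -(a + b) ≠ b := by decide

theorem fin_three_eq_or_third : ∀ {a b : Fin 3}, a ≠ b →
    ∀ j, j = a ∨ j = b ∨ j = -(a + b) := by decide

theorem fin_three_exists_ne : ∀ a b : Fin 3, ∃ c, c ≠ a ∧ c ≠ b := by decide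

theorem hasPairing_or_hasMatching_or_hasCommonCells (E : Fin 3 → Fin 3 → SignType)
    (h0 : ∀ a, E a a = 0) (h1 : ∀ a, E a ≠ 0) :
    (∃ a, ¬(IsDiagonal E a ∧ IsDiagonal E (a + 1)) ∧ HasPairing E a (a + 1)) ∨
      ((∃ a, ¬IsDiagonal E a) ∧ HasMatching E) ∨ HasCommonCells E := by
  have hE : E = ![![0, E 0 1, E 0 2], ![E 1 0, 0, E 1 2], ![E 2 0, E 2 1, 0]] := by
    ext i j
    fin_cases i <;> fin_cases j <;> simp [h0]
  have hne : ∀ a, ¬(E a (a + 1) = 0 ∧ E a (a + 2) = 0) := by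
    rintro a ⟨h2, h3⟩
    apply h1 a
    funext j
    rcases fin_three_cases a j with rfl | rfl | rfl
    exacts [h0 _, h2, h3]
  rw [hE]
  exact sign_cases _ _ _ _ _ _ (hne 0) (hne 1) (hne 2)

/-! ### Diagonally stacked, separated bundles -/

/-- Three bundles of `m` axis-parallel lines, the `i`-th line of the bundle `a` passing through
`P a i`, that are stacked diagonally and separated from each other like the bundles
of `threeBundles`. -/
structure IsBundleFamily (m : ℕ) (P : Fin 3 → ℕ → Space) : Prop where
  sep_left : ∀ {a b c : Fin 3}, a < b → c ≠ a → c ≠ b → ∀ {i : ℕ}, i ∈ Finset.Icc 1 m →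
    P a i c < m + 1 / 2
  sep_right : ∀ {a b c : Fin 3}, a < b → c ≠ a → c ≠ b → ∀ {i : ℕ}, i ∈ Finset.Icc 1 m →
    (m : ℝ) + 1 / 2 < P b i c
  mono : ∀ {a b : Fin 3}, b ≠ a → ¬(a = 1 ∧ b = 2) → ∀ {i j : ℕ}, i ∈ Finset.Icc 1 m →
    j ∈ Finset.Icc 1 m → i < j → P a i b < P a j b
  anti : ∀ {i j : ℕ}, i ∈ Finset.Icc 1 m → j ∈ Finset.Icc 1 m → i < j → P 1 j 2 < P 1 i 2

/-- The lines of three bundles. -/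
def bundleLines (m : ℕ) (P : Fin 3 → ℕ → Space) : Set (AffineSubspace ℝ Space) :=
  {l | ∃ a : Fin 3, ∃ i ∈ Finset.Icc 1 m, l = axisLine a (P a i)}

namespace IsBundleFamily

variable {m : ℕ} {P : Fin 3 → ℕ → Space}

theorem sep (hP : IsBundleFamily m P) {a b c : Fin 3} (hab : a < b) (hca : c ≠ a) (hcb : c ≠ b)
    {i j : ℕ} (hi : i ∈ Finset.Icc 1 m) (hj : j ∈ Finset.Icc 1 m) : P a i c < P b j c :=
  (hP.sep_left hab hca hcb hi).trans (hP.sep_right hab hca hcb hj)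

theorem apply_ne_of_lt (hP : IsBundleFamily m P) {a c : Fin 3} (hc : c ≠ a) {i j : ℕ}
    (hi : i ∈ Finset.Icc 1 m) (hj : j ∈ Finset.Icc 1 m) (hij : i < j) : P a i c ≠ P a j c := by
  by_cases h : a = 1 ∧ c = 2
  · obtain ⟨rfl, rfl⟩ := h
    exact (hP.anti hi hj hij).ne'
  · exact (hP.mono hc h hi hj hij).ne

/-- Stacking distinguishes the lines within a bundle, and separation those of two bundles.
Consequently a plane orthogonal to a coordinate axis contains at most one line. -/
theorem eq_of_apply_eq (hP : IsBundleFamily m P) {a b c : Fin 3} (hca : c ≠ a) (hcb : c ≠ b)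
    {i j : ℕ} (hi : i ∈ Finset.Icc 1 m) (hj : j ∈ Finset.Icc 1 m) (h : P a i c = P b j c) :
    a = b ∧ i = j := by
  rcases lt_trichotomy a b with hab | rfl | hab
  · exact absurd h (hP.sep hab hca hcb hi hj).ne
  · refine ⟨rfl, ?_⟩
    rcases lt_trichotomy i j with hij | hij | hij
    · exact absurd h (hP.apply_ne_of_lt hca hi hj hij)
    · exact hij
    · exact absurd h.symm (hP.apply_ne_of_lt hca hj hi hij)
  · exact absurd h.symm (hP.sep hab hcb hca hj hi).ne

theorem eq_of_axisLine_eq (hP : IsBundleFamily m P) {a b : Fin 3} {i j : ℕ}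
    (hi : i ∈ Finset.Icc 1 m) (hj : j ∈ Finset.Icc 1 m)
    (h : axisLine a (P a i) = axisLine b (P b j)) : a = b ∧ i = j := by
  obtain ⟨c, hca, hcb⟩ := fin_three_exists_ne a b
  have hmem : P a i ∈ axisLine b (P b j) := by
    rw [← h]
    exact mem_axisLine.2 ⟨0, by simp⟩
  exact hP.eq_of_apply_eq hca hcb hi hj (apply_eq_of_mem_axisLine hmem hcb)

end IsBundleFamily

/-! ### Planes that split a bundle -/

/-- The plane is parallel to the bundle `a` and has lines of the bundle on it or on both sides
of it. -/
def Splits (m : ℕ) (P : Fin 3 → ℕ → Space) (ν : Space) (c : ℝ) (a : Fin 3) : Prop :=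
  ν a = 0 ∧ (∃ i ∈ Finset.Icc 1 m, height ν c (P a i) ≤ 0) ∧
    ∃ i ∈ Finset.Icc 1 m, 0 ≤ height ν c (P a i)

theorem height_sub (ν : Space) (c : ℝ) (p q : Space) :
    height ν c p - height ν c q =
      ν 0 * (p 0 - q 0) + ν 1 * (p 1 - q 1) + ν 2 * (p 2 - q 2) := by
  rw [height_eq, height_eq]
  ring

theorem third_coordinate {ν : Space} (hν : ν ≠ 0) {a b : Fin 3} (hab : a ≠ b) (ha : ν a = 0)
    (hb : ν b = 0) :
    ν (-(a + b)) ≠ 0 ∧ ∀ (c : ℝ) (p : Space), height ν c p = ν (-(a + b)) * p (-(a + b)) - c := by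
  constructor
  · intro h
    apply hν
    ext j
    rcases fin_three_eq_or_third hab j with rfl | rfl | rfl
    exacts [ha, hb, h]
  · intro c p
    rw [height_eq]
    fin_cases a <;> fin_cases b <;> simp at hab ha hb ⊢ <;> simp [ha, hb] <;> rfl

/-- The plane fixes the coordinate `-(a + j)`, at a value within the range of the bundle `j`. In
this coordinate the bundle with the smaller index lies entirely below the other, so the bundle `a`
is strictly on one side. -/
theorem Splits.sign_height {m : ℕ} {P : Fin 3 → ℕ → Space} (hP : IsBundleFamily m P) {ν : Space}
    (hν : ν ≠ 0) {c : ℝ} {j a : Fin 3} (hs : Splits m P ν c j) (haj : a ≠ j) (ha : ν a = 0)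
    {i : ℕ} (hi : i ∈ Finset.Icc 1 m) :
    SignType.sign (height ν c (P a i)) =
      (if a < j then -1 else 1) * SignType.sign (ν (-(a + j))) := by
  obtain ⟨hj, ⟨i₁, hi₁, h₁⟩, i₂, hi₂, h₂⟩ := hs
  obtain ⟨hd, hh⟩ := third_coordinate hν haj ha hj
  obtain ⟨hda, hdj⟩ := fin_three_third_ne haj
  rw [hh] at h₁ h₂ ⊢
  generalize -(a + j) = d at *
  rcases lt_or_gt_of_ne haj with h | h
  · have hl₁ := hP.sep h hda hdj hi hi₁
    have hl₂ := hP.sep h hda hdj hi hi₂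
    rw [if_pos h]
    rcases lt_or_gt_of_ne hd with h0 | h0
    · rw [sign_neg h0, sign_pos]
      · rfl
      · nlinarith
    · rw [sign_pos h0, sign_neg]
      · rfl
      · nlinarith
  · have hl₁ := hP.sep h hdj hda hi₁ hi
    have hl₂ := hP.sep h hdj hda hi₂ hi
    rw [if_neg h.not_gt]
    rcases lt_or_gt_of_ne hd with h0 | h0
    · rw [sign_neg h0, sign_neg]
      · rfl
      · nlinarith
    · rw [sign_pos h0, sign_pos]
      · rfl
      · nlinarith

/-- By `Splits.sign_height`, a plane that splits `j` and is parallel to another bundle has all of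
that bundle strictly on one side. -/
theorem Splits.unique {m : ℕ} {P : Fin 3 → ℕ → Space} (hP : IsBundleFamily m P) {ν : Space}
    (hν : ν ≠ 0) {c : ℝ} {j a : Fin 3} (hj : Splits m P ν c j) (ha : Splits m P ν c a) :
    a = j := by
  by_contra haj
  have hd := (third_coordinate hν haj ha.1 hj.1).1
  obtain ⟨i₁, hi₁, h₁⟩ := ha.2.1
  obtain ⟨i₂, hi₂, h₂⟩ := ha.2.2
  have e₁ := hj.sign_height hP hν haj ha.1 hi₁
  have e₂ := hj.sign_height hP hν haj ha.1 hi₂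
  rw [← e₁] at e₂
  have hne : SignType.sign (height ν c (P a i₁)) ≠ 0 := by
    rw [e₁]
    exact mul_ne_zero (by split_ifs <;> decide) (sign_ne_zero.2 hd)
  have hne₂ : height ν c (P a i₂) ≠ 0 := by rw [← sign_ne_zero, e₂]; exact hne
  rw [sign_ne_zero] at hne
  rw [sign_pos (lt_of_le_of_ne h₂ hne₂.symm), sign_neg (lt_of_le_of_ne h₁ hne)] at e₂
  exact absurd e₂ (by decide)

theorem sign_mul_sign_of_add_eq_zero {x y p q : ℝ} (hp : 0 < p) (hq : 0 < q) (hx : x ≠ 0 ∨ y ≠ 0)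
    (h : x * p + y * q = 0) : SignType.sign x * SignType.sign y = -1 := by
  rcases lt_trichotomy x 0 with h0 | h0 | h0
  · have : 0 < y := by
      by_contra hy
      nlinarith [mul_nonpos_of_nonpos_of_nonneg (not_lt.1 hy) hq.le]
    rw [sign_neg h0, sign_pos this]; rfl
  · subst h0
    have : y = 0 := by
      rcases mul_eq_zero.1 (show y * q = 0 by linarith) with h | h
      · exact h
      · exact absurd h hq.ne'
    simp [this] at hx
  · have : y < 0 := by
      by_contra hy
      nlinarith [mul_nonneg (not_lt.1 hy) hq.le]
    rw [sign_pos h0, sign_neg this]; rfl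

/-- The normal is orthogonal to the difference of the two base points. The two relevant coordinates
of this difference have equal signs, except for the bundle 1, where they have opposite signs. -/
theorem IsBundleFamily.isDiagonal_of_mem {m : ℕ} {P : Fin 3 → ℕ → Space}
    (hP : IsBundleFamily m P) {ν : Fin 3 → Space} {c : ℝ} {a : Fin 3} (hν : ν a ≠ 0)
    (ha : ν a a = 0) {i j : ℕ}
    (hi : i ∈ Finset.Icc 1 m) (hj : j ∈ Finset.Icc 1 m) (hij : i < j)
    (h₁ : height (ν a) c (P a i) = 0) (h₂ : height (ν a) c (P a j) = 0) :
    IsDiagonal (fun j a => SignType.sign (ν j a)) a := by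
  have h := height_sub (ν a) c (P a j) (P a i)
  rw [h₁, h₂, sub_zero] at h
  have hne : ν a (a + 1) ≠ 0 ∨ ν a (a + 2) ≠ 0 := by
    by_contra hc
    push Not at hc
    apply hν
    ext d
    rcases fin_three_cases a d with rfl | rfl | rfl
    exacts [ha, hc.1, hc.2]
  unfold IsDiagonal
  fin_cases a
  · have m₁ := hP.mono (a := 0) (b := 1) (by decide) (by decide) hi hj hij
    have m₂ := hP.mono (a := 0) (b := 2) (by decide) (by decide) hi hj hij
    exact sign_mul_sign_of_add_eq_zero (sub_pos.2 m₁) (sub_pos.2 m₂) hne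
      (by simp at *; rw [ha] at h; linarith)
  · have m₁ := hP.anti hi hj hij
    have m₂ := hP.mono (a := 1) (b := 0) (by decide) (by decide) hi hj hij
    -- The last coordinate decreases along the bundle 1. Negating its coefficient makes both
    -- differences positive.
    have := sign_mul_sign_of_add_eq_zero (x := - ν 1 2) (y := ν 1 0) (sub_pos.2 m₁) (sub_pos.2 m₂)
      (hne.imp neg_ne_zero.2 id) (by simp at *; rw [ha] at h; linarith)
    rw [Left.sign_neg, neg_mul, neg_inj] at this
    exact this
  · have m₁ := hP.mono (a := 2) (b := 0) (by decide) (by decide) hi hj hij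
    have m₂ := hP.mono (a := 2) (b := 1) (by decide) (by decide) hi hj hij
    exact sign_mul_sign_of_add_eq_zero (sub_pos.2 m₁) (sub_pos.2 m₂) hne
      (by simp at *; rw [ha] at h; linarith)

/-! ### Counting lines in the cells at infinity -/

/-- At most `k` lines of the bundles meet any one open cell of the planes `height (ν j) (c j) = 0`. -/
def CellBound (m : ℕ) (P : Fin 3 → ℕ → Space) (ν : Fin 3 → Space) (c : Fin 3 → ℝ) (k : ℕ) : Prop :=
  ∀ (s : Fin 3 → SignType) (F : Finset (Σ _ : Fin 3, ℕ)), (∀ j, s j ≠ 0) →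
    (∀ x ∈ F, x.2 ∈ Finset.Icc 1 m ∧ ∃ t : ℝ, ∀ j,
      SignType.sign (height (ν j) (c j) (P x.1 x.2 + t • axisVec x.1)) = s j) → F.card ≤ k

/-- The number of lines of the bundle `a` that have the sign `s` with respect to the plane that
splits the bundle. -/
noncomputable def sideCount (m : ℕ) (P : Fin 3 → ℕ → Space) (ν : Fin 3 → Space) (c : Fin 3 → ℝ)
    (a : Fin 3) (s : SignType) : ℕ :=
  ((Finset.Icc 1 m).filter fun i => SignType.sign (height (ν a) (c a) (P a i)) = s).card

section Counting

variable {m k : ℕ} {P : Fin 3 → ℕ → Space} {ν : Fin 3 → Space} {c : Fin 3 → ℝ}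

theorem sideCount_add (a : Fin 3) :
    sideCount m P ν c a 1 + sideCount m P ν c a (-1) + sideCount m P ν c a 0 = m := by
  have h := Finset.card_eq_sum_card_fiberwise (s := Finset.Icc 1 m) (t := Finset.univ)
    (f := fun i => SignType.sign (height (ν a) (c a) (P a i))) (fun _ _ => by simp)
  rw [Nat.card_Icc, show (Finset.univ : Finset SignType) = {0, -1, 1} from rfl] at h
  rw [Finset.sum_insert (by decide), Finset.sum_insert (by decide), Finset.sum_singleton] at h
  simp only [sideCount]
  omega

/-- Each plane that does not split the bundle has, far out in the positive direction, all its lines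
strictly on one side. If no plane split it, all `m > k` lines would enter one cell. -/
theorem CellBound.exists_splits (h : CellBound m P ν c k) (hk : k < m) (a : Fin 3) :
    ∃ j, Splits m P (ν j) (c j) a := by
  by_contra hc
  push Not at hc
  have hs : ∀ j, ∃ s : SignType, s ≠ 0 ∧ ∀ i ∈ Finset.Icc 1 m,
      (if ν j a = 0 then SignType.sign (height (ν j) (c j) (P a i))
        else 1 * SignType.sign (ν j a)) = s := by
    intro j
    by_cases h0 : ν j a = 0
    · simp only [if_pos h0]
      by_cases h1 : ∃ i ∈ Finset.Icc 1 m, height (ν j) (c j) (P a i) ≤ 0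
      · refine ⟨-1, by decide, fun i hi => sign_neg ?_⟩
        by_contra h2
        exact hc j ⟨h0, h1, i, hi, not_lt.1 h2⟩
      · push Not at h1
        exact ⟨1, by decide, fun i hi => sign_pos (h1 i hi)⟩
    · exact ⟨SignType.sign (ν j a), sign_ne_zero.2 h0, by simp [h0]⟩
  choose s hs0 hs using hs
  have := h s (({a} : Finset (Fin 3)).sigma fun _ => Finset.Icc 1 m) hs0 (by
    rintro ⟨b, i⟩ hx
    rw [Finset.mem_sigma, Finset.mem_singleton] at hx
    obtain ⟨rfl, hi⟩ := hx
    obtain ⟨t, ht⟩ := exists_far_sign (fun j => height (ν j) (c j) (P b i)) (fun j => ν j b)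
      (τ := 1) (by decide)
    exact ⟨hi, t, fun j => by rw [height_on_axisLine, ht j]; exact hs j i hi⟩)
  rw [Finset.card_sigma] at this
  simp at this
  omega

/-- Followed to a suitable end, all the counted lines enter the cell with sign vector `s`. The sign
for the own plane is constant along the line, and the other two are given by `farSign`. -/
theorem CellBound.sum_sideCount_le (h : CellBound m P ν c k) (hP : IsBundleFamily m P)
    (hν : ∀ j, ν j ≠ 0) (hsplit : ∀ a, Splits m P (ν a) (c a) a) {s : Fin 3 → SignType}
    (hs : ∀ j, s j ≠ 0) {A : Finset (Fin 3)}
    (hA : ∀ a ∈ A, Reaches (fun j a => SignType.sign (ν j a)) a s) :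
    ∑ a ∈ A, sideCount m P ν c a (s a) ≤ k := by
  have := h s (A.sigma fun a => (Finset.Icc 1 m).filter
    fun i => SignType.sign (height (ν a) (c a) (P a i)) = s a) hs (by
    rintro ⟨a, i⟩ hx
    rw [Finset.mem_sigma, Finset.mem_filter] at hx
    obtain ⟨ha, hi, hsa⟩ := hx
    obtain ⟨τ, hτ, h₁, h₂⟩ := (hA a ha).exists
    obtain ⟨t, ht⟩ := exists_far_sign (fun j => height (ν j) (c j) (P a i)) (fun j => ν j a) hτ
    have hfar : ∀ j, j ≠ a → farSign (fun j a => SignType.sign (ν j a)) j a τ = s j →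
        SignType.sign (height (ν j) (c j) (P a i + t • axisVec a)) = s j := by
      intro j hj hf
      rw [height_on_axisLine, ht j, ← hf]
      simp only [farSign, sign_eq_zero_iff]
      split_ifs with h0 h1
      · rw [(hsplit j).sign_height hP (hν j) hj.symm h0 hi, if_pos h1]
      · rw [(hsplit j).sign_height hP (hν j) hj.symm h0 hi, if_neg h1]
      · rfl
    refine ⟨hi, t, fun j => ?_⟩
    rcases fin_three_cases a j with rfl | rfl | rfl
    · rw [height_on_axisLine, (hsplit j).1, mul_zero, add_zero]
      exact hsa
    · exact hfar _ (fin_three_add_one_ne a) h₁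
    · exact hfar _ (fin_three_add_two_ne a) h₂)
  rwa [Finset.card_sigma] at this

theorem CellBound.add_le_of_meet (h : CellBound m P ν c k) (hP : IsBundleFamily m P)
    (hν : ∀ j, ν j ≠ 0) (hsplit : ∀ a, Splits m P (ν a) (c a) a) {a b : Fin 3} (hab : a ≠ b)
    {s t : SignType} (hs : s ≠ 0) (ht : t ≠ 0)
    (hm : Meet (fun j a => SignType.sign (ν j a)) a b s t) :
    sideCount m P ν c a s + sideCount m P ν c b t ≤ k := by
  obtain ⟨r, hr, h₁, h₂⟩ := hm.exists
  have := h.sum_sideCount_le hP hν hsplit (A := {a, b})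
    (s := fun j => if j = a then s else if j = b then t else r)
    (fun j => by split_ifs <;> assumption)
    (fun d hd => by
      rcases Finset.mem_insert.1 hd with rfl | hd
      · exact h₁
      · rw [Finset.mem_singleton.1 hd]; exact h₂)
  rw [Finset.sum_pair hab] at this
  simpa [hab.symm] using this

theorem CellBound.le_of_splits (h : CellBound m P ν c k) (hP : IsBundleFamily m P)
    (hν : ∀ j, ν j ≠ 0) (hsplit : ∀ a, Splits m P (ν a) (c a) a) (hm : 3 ≤ m)
    (h2 : ∀ a, sideCount m P ν c a 0 ≤ 2) : m ≤ k + 1 := by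
  by_contra hk
  have hadd := sideCount_add (m := m) (P := P) (ν := ν) (c := c)
  have h1 : ∀ a, ¬IsDiagonal (fun j a => SignType.sign (ν j a)) a → sideCount m P ν c a 0 ≤ 1 := by
    intro a ha
    refine Finset.card_le_one.2 fun i hi j hj => ?_
    simp only [Finset.mem_filter, sign_eq_zero_iff] at hi hj
    by_contra hij
    rcases lt_or_gt_of_ne hij with hij | hij
    · exact ha (hP.isDiagonal_of_mem (hν a) (hsplit a).1 hi.1 hj.1 hij hi.2 hj.2)
    · exact ha (hP.isDiagonal_of_mem (hν a) (hsplit a).1 hj.1 hi.1 hij hj.2 hi.2)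
  have hmeet := fun {a b : Fin 3} (hab : a ≠ b) {s t : SignType} (hs : s ≠ 0) (ht : t ≠ 0) =>
    h.add_le_of_meet hP hν hsplit (s := s) (t := t) hab hs ht
  rcases hasPairing_or_hasMatching_or_hasCommonCells (fun j a => SignType.sign (ν j a))
    (fun a => by simp [(hsplit a).1])
    (fun a h0 => hν a (by ext j; exact sign_eq_zero_iff.1 (congrFun h0 j))) with
    ⟨a, hnd, hp⟩ | ⟨⟨a, ha⟩, hM⟩ | hC
  -- Two cells cover both bundles up to three lines on the planes: 2m ≤ 2k + 3.
  · have hab : a ≠ a + 1 := (fin_three_add_one_ne a).symm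
    have hr : sideCount m P ν c a 0 + sideCount m P ν c (a + 1) 0 ≤ 3 := by
      have := h2 a
      have := h2 (a + 1)
      by_cases hd : IsDiagonal (fun j a => SignType.sign (ν j a)) a
      · have := h1 (a + 1) fun hd' => hnd ⟨hd, hd'⟩
        omega
      · have := h1 a hd
        omega
    have := hadd a
    have := hadd (a + 1)
    rcases hp with ⟨h₁, h₂⟩ | ⟨h₁, h₂⟩
    · have := hmeet hab (by decide) (by decide) h₁
      have := hmeet hab (by decide) (by decide) h₂
      omega
    · have := hmeet hab (by decide) (by decide) h₁
      have := hmeet hab (by decide) (by decide) h₂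
      rw [neg_neg] at this
      omega
  -- Three cells cover everything up to five lines on the planes: 3m ≤ 3k + 5.
  · have hr : sideCount m P ν c 0 0 + sideCount m P ν c 1 0 + sideCount m P ν c 2 0 ≤ 5 := by
      have := h2 0
      have := h2 1
      have := h2 2
      have := h1 a ha
      fin_cases a <;> simp at this <;> omega
    have := hadd 0
    have := hadd 1
    have := hadd 2
    obtain ⟨s, hs, t, ht, h₁, r, hr, h₂, h₃⟩ : ∃ s : SignType, s ≠ 0 ∧ ∃ t : SignType, t ≠ 0 ∧
        Meet (fun j a => SignType.sign (ν j a)) 0 1 s t ∧ ∃ r : SignType, r ≠ 0 ∧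
        Meet (fun j a => SignType.sign (ν j a)) 1 2 (-t) r ∧
        Meet (fun j a => SignType.sign (ν j a)) 0 2 (-s) (-r) := by
      obtain ⟨s, hs, h'⟩ := hM.exists
      obtain ⟨t, ht, h₁, h'⟩ := h'.exists
      exact ⟨s, hs, t, ht, h₁, h'.exists⟩
    have hneg : ∀ {x : SignType}, x ≠ 0 → -x ≠ 0 := by decide
    have c₁ := hmeet (by decide) hs ht h₁
    have c₂ := hmeet (by decide) (hneg ht) hr h₂
    have c₃ := hmeet (by decide) (hneg hs) (hneg hr) h₃
    have hpair : ∀ a, ∀ x : SignType, x ≠ 0 →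
        sideCount m P ν c a x + sideCount m P ν c a (-x) =
        sideCount m P ν c a 1 + sideCount m P ν c a (-1) := by
      intro a x hx
      cases x
      · exact absurd rfl hx
      · exact add_comm _ _
      · rfl
    have := hpair 0 s hs
    have := hpair 1 t ht
    have := hpair 2 r hr
    omega
  -- Two cells cover everything up to six lines on the planes: 3m ≤ 2k + 6. With k + 2 ≤ m this
  -- leaves m ≤ 2, so only this case needs `3 ≤ m`.
  · obtain ⟨t, ht, h'⟩ := hC.exists
    obtain ⟨r, hr, h'⟩ := h'.exists
    have hneg : ∀ {x : SignType}, x ≠ 0 → -x ≠ 0 := by decide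
    have c₁ := h.sum_sideCount_le hP hν hsplit (s := ![1, t, r]) (A := Finset.univ)
      (fun j => by fin_cases j <;> simp [ht, hr]) (fun a _ => (h' a).1)
    have c₂ := h.sum_sideCount_le hP hν hsplit (s := ![-1, -t, -r]) (A := Finset.univ)
      (fun j => by fin_cases j <;> simp [ht, hr]) (fun a _ => (h' a).2)
    rw [Fin.sum_univ_three] at c₁ c₂
    simp at c₁ c₂
    have hpair : ∀ a, ∀ x : SignType, x ≠ 0 →
        sideCount m P ν c a x + sideCount m P ν c a (-x) =
        sideCount m P ν c a 1 + sideCount m P ν c a (-1) := by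
      intro a x hx
      cases x
      · exact absurd rfl hx
      · exact add_comm _ _
      · rfl
    have := hpair 1 t ht
    have := hpair 2 r hr
    have := hadd 0
    have := hadd 1
    have := hadd 2
    have := h2 0
    have := h2 1
    have := h2 2
    omega

/-- Every bundle is split and no plane splits two bundles, so the planes can be relabelled by the
bundles they split. -/
theorem CellBound.le (h : CellBound m P ν c k) (hP : IsBundleFamily m P)
    (hν : ∀ j, ν j ≠ 0) (hm : 3 ≤ m)
    (h2 : ∀ j a, ν j a = 0 → ((Finset.Icc 1 m).filter
      fun i => SignType.sign (height (ν j) (c j) (P a i)) = 0).card ≤ 2) : m ≤ k + 1 := by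
  by_contra hk
  choose f hf using h.exists_splits (by omega)
  have hinj : Function.Injective f := fun a b hab =>
    (hf b).unique hP (hν _) (hab ▸ hf a)
  have hbij : Function.Bijective f := Finite.injective_iff_bijective.1 hinj
  let e := Equiv.ofBijective f hbij
  have h' : CellBound m P (fun a => ν (f a)) (fun a => c (f a)) k := by
    intro s F hs hF
    refine h (fun j => s (e.symm j)) F (fun j => hs _) fun x hx => ?_
    obtain ⟨hi, t, ht⟩ := hF x hx
    refine ⟨hi, t, fun j => ?_⟩
    obtain ⟨a, rfl⟩ := e.surjective j
    rw [e.symm_apply_apply]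
    exact ht a
  exact hk (h'.le_of_splits hP (fun a => hν _) hf hm fun a => h2 (f a) a (hf a).1)

end Counting

/-! ### From cells to sign vectors; the lower bounds -/

/-- The line with index `x` in a family of bundles. -/
noncomputable def indexedLine (P : Fin 3 → ℕ → Space) (x : Σ _ : Fin 3, ℕ) :
    AffineSubspace ℝ Space := axisLine x.1 (P x.1 x.2)

theorem IsBundleFamily.indexedLine_injOn {m : ℕ} {P : Fin 3 → ℕ → Space}
    (hP : IsBundleFamily m P) :
    Set.InjOn (indexedLine P) {x | x.2 ∈ Finset.Icc 1 m} := by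
  rintro ⟨a, i⟩ hi ⟨b, j⟩ hj h
  obtain ⟨rfl, rfl⟩ := hP.eq_of_axisLine_eq hi hj h
  rfl

theorem IsBundleFamily.card_le_of_encard_le {m k : ℕ} {P : Fin 3 → ℕ → Space}
    (hP : IsBundleFamily m P) {F : Finset (Σ _ : Fin 3, ℕ)}
    (hF : ∀ x ∈ F, x.2 ∈ Finset.Icc 1 m)
    {S : Set (AffineSubspace ℝ Space)} (hS : S.encard ≤ k) (hFS : ∀ x ∈ F, indexedLine P x ∈ S) :
    F.card ≤ k := by
  have h1 : (indexedLine P '' (F : Set (Σ _ : Fin 3, ℕ))).encard = F.card := by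
    rw [Set.InjOn.encard_image (hP.indexedLine_injOn.mono hF), Set.encard_coe_eq_coe_finsetCard]
  have h2 : (indexedLine P '' (F : Set (Σ _ : Fin 3, ℕ))) ⊆ S := by
    rintro _ ⟨x, hx, rfl⟩
    exact hFS x hx
  exact_mod_cast h1 ▸ (Set.encard_le_encard h2).trans hS

theorem IsPlaneTriple.exists_levelPlane {H : Set (AffineSubspace ℝ Space)} (hH : IsPlaneTriple H) :
    ∃ (ν : Fin 3 → Space) (c : Fin 3 → ℝ), (∀ j, ν j ≠ 0) ∧
      H = Set.range fun j => levelPlane (ν j) (c j) := by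
  obtain ⟨x, y, z, -, -, -, rfl⟩ := Set.ncard_eq_three.1 hH.1
  have h : ∀ j, ∃ (ν : Space) (c : ℝ), ν ≠ 0 ∧ ![x, y, z] j = levelPlane ν c :=
    fun j => IsPlane.exists_eq_levelPlane (hH.2 _ (by fin_cases j <;> simp))
  choose ν c hν h using h
  refine ⟨ν, c, hν, ?_⟩
  simp_rw [← h]
  ext q
  rw [Set.mem_range, Fin.exists_fin_succ, Fin.exists_fin_two]
  simp [eq_comm]

/-- The planes `i` and `j` are distinct because exactly one of them is parallel to the axis `i`. -/
theorem isPlaneTriple_range {ν : Fin 3 → Space} {c : Fin 3 → ℝ} (hν : ∀ j, ν j ≠ 0)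
    (hne : ∀ i j, i ≠ j → ¬(ν i i = 0 ↔ ν j i = 0)) :
    IsPlaneTriple (Set.range fun j => levelPlane (ν j) (c j)) := by
  refine ⟨?_, ?_⟩
  · have hinj : Function.Injective fun j => levelPlane (ν j) (c j) := by
      intro i j hij
      by_contra h
      refine hne i j h ?_
      rw [← mem_direction_levelPlane (c := c i), ← mem_direction_levelPlane (c := c j)]
      exact iff_of_eq (congrArg (fun h => axisVec i ∈ AffineSubspace.direction h) hij)
    rw [← Set.image_univ, Set.ncard_image_of_injective _ hinj, Set.ncard_univ]
    simp
  · rintro _ ⟨j, rfl⟩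
    exact isPlane_levelPlane (hν j) _

theorem CellsMeetAtMost.cellBound {m k : ℕ} {P : Fin 3 → ℕ → Space} (hP : IsBundleFamily m P)
    {ν : Fin 3 → Space} {c : Fin 3 → ℝ} (hν : ∀ j, ν j ≠ 0)
    (h : CellsMeetAtMost (Set.range fun j => levelPlane (ν j) (c j)) (bundleLines m P) k) :
    CellBound m P ν c k := by
  intro s F hs hF
  -- The sign vector `s` need not be realised by any point. If `F` is nonempty, its first witness
  -- represents the cell.
  rcases F.eq_empty_or_nonempty with rfl | ⟨x₀, hx₀⟩
  · simp
  obtain ⟨-, t₀, ht₀⟩ := hF x₀ hx₀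
  set p := P x₀.1 x₀.2 + t₀ • axisVec x₀.1
  have hp : ∀ j, height (ν j) (c j) p ≠ 0 := fun j => by
    rw [← sign_ne_zero, ht₀ j]
    exact hs j
  refine hP.card_le_of_encard_le (fun x hx => (hF x hx).1) (h _ ⟨p, ?_, rfl⟩) ?_
  · rintro _ ⟨j, rfl⟩
    rw [mem_levelPlane (hν j)]
    exact hp j
  · intro x hx
    obtain ⟨hi, t, ht⟩ := hF x hx
    refine ⟨⟨x.1, x.2, hi, rfl⟩, _, mem_axisLine.2 ⟨t, rfl⟩, ?_⟩
    rintro _ ⟨j, rfl⟩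
    exact (sSameSide_levelPlane_iff (hν j) (hp j)).2 ((ht₀ j).trans (ht j).symm)

theorem le_of_cellsMeetAtMost {m k : ℕ} {P : Fin 3 → ℕ → Space} (hP : IsBundleFamily m P)
    (hm : 3 ≤ m) (h3 : NoThreeCoplanar (bundleLines m P)) {H : Set (AffineSubspace ℝ Space)}
    (hH : IsPlaneTriple H) (h : CellsMeetAtMost H (bundleLines m P) k) : m - 1 ≤ k := by
  obtain ⟨ν, c, hν, rfl⟩ := hH.exists_levelPlane
  rw [Nat.sub_le_iff_le_add]
  refine (h.cellBound hP hν).le hP hν hm fun j a hja => ?_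
  have := hP.card_le_of_encard_le (k := 2) (F := ({a} : Finset (Fin 3)).sigma fun _ =>
    (Finset.Icc 1 m).filter fun i => SignType.sign (height (ν j) (c j) (P a i)) = 0)
    (S := {l | l ∈ bundleLines m P ∧ l ≤ levelPlane (ν j) (c j)})
    (by
      rintro ⟨b, i⟩ hx
      exact (Finset.mem_filter.1 (Finset.mem_sigma.1 hx).2).1)
    (h3 _ (isPlane_levelPlane (hν j) _))
    (by
      rintro ⟨b, i⟩ hx
      rw [Finset.mem_sigma, Finset.mem_singleton, Finset.mem_filter] at hx
      obtain ⟨rfl, hi, h0⟩ := hx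
      exact ⟨⟨b, i, hi, rfl⟩, (axisLine_le_levelPlane (hν j)).2 ⟨hja, sign_eq_zero_iff.1 h0⟩⟩)
  rwa [Finset.card_sigma, Finset.sum_singleton] at this

/-- If no open cell met a line, each of six chosen lines would lie on one of the planes. An
axis-parallel plane contains at most one of them, and there are only three planes. -/
theorem one_le_of_cellsMeetAtMost {m k : ℕ} {P : Fin 3 → ℕ → Space} (hP : IsBundleFamily m P)
    (hm : 2 ≤ m) {H : Set (AffineSubspace ℝ Space)}
    (hH : IsAxisParallelTriple H) (h : CellsMeetAtMost H (bundleLines m P) k) : 1 ≤ k := by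
  obtain ⟨ν, c, hν, rfl⟩ := hH.1.exists_levelPlane
  by_contra hk
  have hmem : ∀ x : Fin 3 × Fin 2, x.2.1 + 1 ∈ Finset.Icc 1 m := by
    rintro ⟨a, i⟩
    rw [Finset.mem_Icc]
    constructor
    · exact Nat.le_add_left _ _
    · exact le_trans i.2 hm
  -- A line contained in none of the planes has only nonzero signs far out, hence meets an open
  -- cell.
  have hon : ∀ x : Fin 3 × Fin 2, ∃ j, ν j x.1 = 0 ∧
      height (ν j) (c j) (P x.1 (x.2.1 + 1)) = 0 := by
    intro x
    by_contra hc
    push Not at hc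
    obtain ⟨t, ht⟩ := exists_far_sign (fun j => height (ν j) (c j) (P x.1 (x.2.1 + 1)))
      (fun j => ν j x.1) (τ := 1) (by decide)
    have := h.cellBound hP hν _ {⟨x.1, x.2.1 + 1⟩} (fun j => ?_) (fun y hy => by
      rw [Finset.mem_singleton] at hy
      subst hy
      exact ⟨hmem x, t, fun j => by rw [height_on_axisLine, ht j]⟩)
    · rw [Finset.card_singleton] at this
      exact hk this
    · split_ifs with h0
      · exact sign_ne_zero.2 (hc j h0)
      · exact mul_ne_zero (by decide) (sign_ne_zero.2 h0)
  choose f hf0 hf using hon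
  have hinj : Function.Injective f := by
    intro x y hxy
    obtain ⟨a, b, hab, ha, hb⟩ := hH.2 _ ⟨f x, rfl⟩
    obtain ⟨hd, hh⟩ := third_coordinate (hν (f x)) hab (mem_direction_levelPlane.1 ha)
      (mem_direction_levelPlane.1 hb)
    generalize -(a + b) = d at hd hh
    have hy0 := hf0 y
    have hy := hf y
    rw [← hxy, hh] at hy
    rw [← hxy] at hy0
    have hx := hf x
    rw [hh] at hx
    obtain ⟨h1, h2⟩ := hP.eq_of_apply_eq (a := x.1) (b := y.1) (c := d)
      (fun e => hd (e ▸ hf0 x)) (fun e => hd (e ▸ hy0)) (hmem x) (hmem y)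
      (mul_left_cancel₀ hd (by linarith))
    exact Prod.ext h1 (Fin.ext (Nat.succ_injective h2))
  have := Fintype.card_le_of_injective f hinj
  simp at this

/-! ### Splitting planes for the upper bounds -/

theorem height_axisVec (a : Fin 3) (c : ℝ) (q : Space) : height (axisVec a) c q = q a - c := by
  rw [height, axisVec, EuclideanSpace.inner_single_left]
  simp

theorem axisVec_ne_zero (a : Fin 3) : axisVec a ≠ 0 := by simp [axisVec]

theorem isOrthogonalAxisParallelTriple_range (c : Fin 3 → ℝ) :
    IsOrthogonalAxisParallelTriple (Set.range fun j => levelPlane (axisVec j) (c j)) := by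
  refine ⟨⟨isPlaneTriple_range axisVec_ne_zero ?_, ?_⟩, ?_⟩
  · intro i j h
    simp [axisVec, h]
  · rintro _ ⟨j, rfl⟩
    refine ⟨j + 1, j + 2, ?_, ?_, ?_⟩
    · revert j; decide
    · rw [mem_direction_levelPlane]
      simp [axisVec]
    · rw [mem_direction_levelPlane]
      simp [axisVec]
  · rintro _ ⟨i, rfl⟩ _ ⟨j, rfl⟩ hij
    have hne : i ≠ j := fun h => hij (h ▸ rfl)
    rw [OrthogonalPlanes, direction_levelPlane, direction_levelPlane,
      Submodule.orthogonal_orthogonal, Submodule.orthogonal_orthogonal, Submodule.isOrtho_span]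
    rintro _ rfl _ rfl
    rw [axisVec, EuclideanSpace.inner_single_left]
    simp [axisVec, hne]

theorem exists_cellsMeetAtMost {m : ℕ} {P : Fin 3 → ℕ → Space} (hP : IsBundleFamily m P)
    (hm : 1 ≤ m) : ∃ H, IsOrthogonalAxisParallelTriple H ∧
      CellsMeetAtMost H (bundleLines m P) (m - 1) := by
  -- Each plane passes through the line of one bundle that is nearest, in that coordinate, to the
  -- other bundle not parallel to it. It therefore separates the rest of its own bundle from that
  -- other bundle.
  refine ⟨_, isOrthogonalAxisParallelTriple_range ![P 2 1 0, P 0 m 1, P 1 m 2], ?_⟩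
  rintro _ ⟨p, hp, rfl⟩
  have hp' : ∀ j, p j ≠ ![P 2 1 0, P 0 m 1, P 1 m 2] j := fun j h =>
    hp _ ⟨j, rfl⟩ ((mem_levelPlane (axisVec_ne_zero j)).2 (by rw [height_axisVec, h, sub_self]))
  have h1 : 1 ∈ Finset.Icc 1 m := Finset.mem_Icc.2 ⟨le_rfl, hm⟩
  have hm' : m ∈ Finset.Icc 1 m := Finset.mem_Icc.2 ⟨hm, le_rfl⟩
  have hline : ∀ (a : Fin 3) (i : ℕ), (∃ q ∈ axisLine a (P a i), ∀ j,
      (levelPlane (axisVec j) (![P 2 1 0, P 0 m 1, P 1 m 2] j)).SSameSide p q) →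
      ∀ j, j ≠ a → P a i j ≠ ![P 2 1 0, P 0 m 1, P 1 m 2] j ∧
        (p j < ![P 2 1 0, P 0 m 1, P 1 m 2] j ↔ P a i j < ![P 2 1 0, P 0 m 1, P 1 m 2] j) := by
    rintro a i ⟨q, hq, hs⟩ j hj
    have h := (sSameSide_levelPlane_iff (axisVec_ne_zero j)
      (by rw [height_axisVec]; exact sub_ne_zero.2 (hp' j))).1 (hs j)
    rw [height_axisVec, height_axisVec, apply_eq_of_mem_axisLine hq hj] at h
    refine ⟨fun h0 => ?_, ?_⟩
    · rw [h0, sub_self, sign_zero, sign_eq_zero_iff] at h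
      exact hp' j (sub_eq_zero.1 h)
    · rw [← sub_neg (a := p j), ← sub_neg (a := P a i j), ← sign_eq_neg_one_iff, h,
        sign_eq_neg_one_iff]
  have hbound : ∀ (a : Fin 3) (d : ℕ), d ∈ Finset.Icc 1 m →
      (∀ b, ∀ i ∈ Finset.Icc 1 m, (∀ j, j ≠ b → P b i j ≠ ![P 2 1 0, P 0 m 1, P 1 m 2] j ∧
        (p j < ![P 2 1 0, P 0 m 1, P 1 m 2] j ↔ P b i j < ![P 2 1 0, P 0 m 1, P 1 m 2] j)) →
        b = a ∧ i ≠ d) →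
      {l : AffineSubspace ℝ Space | l ∈ bundleLines m P ∧ ((l : Set Space) ∩ {q | ∀ h ∈
        Set.range fun j => levelPlane (axisVec j) (![P 2 1 0, P 0 m 1, P 1 m 2] j),
        h.SSameSide p q}).Nonempty}.encard ≤ (m - 1 : ℕ) := by
    intro a d hd hbd
    have hsub : {l : AffineSubspace ℝ Space | l ∈ bundleLines m P ∧ ((l : Set Space) ∩ {q | ∀ h ∈
        Set.range fun j => levelPlane (axisVec j) (![P 2 1 0, P 0 m 1, P 1 m 2] j),
        h.SSameSide p q}).Nonempty} ⊆
        (fun i => axisLine a (P a i)) '' (((Finset.Icc 1 m).erase d : Finset ℕ) : Set ℕ) := by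
      rintro _ ⟨⟨b, i, hi, rfl⟩, q, hq, hs⟩
      obtain ⟨rfl, hid⟩ := hbd b i hi (hline b i ⟨q, hq, fun j => hs _ ⟨j, rfl⟩⟩)
      exact ⟨i, Finset.mem_coe.2 (Finset.mem_erase.2 ⟨hid, hi⟩), rfl⟩
    refine (Set.encard_le_encard hsub).trans ((Set.encard_image_le _ _).trans ?_)
    rw [Set.encard_coe_eq_coe_finsetCard, Finset.card_erase_of_mem hd, Nat.card_Icc,
      Nat.add_sub_cancel]
  have hX : ∀ i ∈ Finset.Icc 1 m, P 0 i 1 ≠ P 0 m 1 → P 0 i 1 < P 0 m 1 := fun i hi hne =>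
    hP.mono (by decide) (by decide) hi hm' (lt_of_le_of_ne (Finset.mem_Icc.1 hi).2
      (fun h => hne (by rw [h])))
  have hY : ∀ i ∈ Finset.Icc 1 m, P 1 i 2 ≠ P 1 m 2 → P 1 m 2 < P 1 i 2 := fun i hi hne =>
    hP.anti hi hm' (lt_of_le_of_ne (Finset.mem_Icc.1 hi).2 (fun h => hne (by rw [h])))
  have hZ : ∀ i ∈ Finset.Icc 1 m, P 2 i 0 ≠ P 2 1 0 → P 2 1 0 < P 2 i 0 := fun i hi hne =>
    hP.mono (by decide) (by decide) h1 hi (lt_of_le_of_ne (Finset.mem_Icc.1 hi).1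
      (fun h => hne (by rw [← h])))
  have hX' : ∀ i ∈ Finset.Icc 1 m, P 0 i 2 < P 1 m 2 := fun i hi =>
    hP.sep (by decide) (by decide) (by decide) hi hm'
  have hY' : ∀ i ∈ Finset.Icc 1 m, P 1 i 0 < P 2 1 0 := fun i hi =>
    hP.sep (by decide) (by decide) (by decide) hi h1
  have hZ' : ∀ i ∈ Finset.Icc 1 m, P 0 m 1 < P 2 i 1 := fun i hi =>
    hP.sep (by decide) (by decide) (by decide) hm' hi
  -- Any two of the three alternatives contradict each other in one coordinate of `p`, so a cell
  -- meets lines of one bundle only, and never the line lying on a plane.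
  have hsigns : ∀ b, ∀ i ∈ Finset.Icc 1 m,
      (∀ j, j ≠ b → P b i j ≠ ![P 2 1 0, P 0 m 1, P 1 m 2] j ∧
        (p j < ![P 2 1 0, P 0 m 1, P 1 m 2] j ↔ P b i j < ![P 2 1 0, P 0 m 1, P 1 m 2] j)) →
      (b = 0 ∧ i ≠ m ∧ p 1 < P 0 m 1 ∧ p 2 < P 1 m 2) ∨
      (b = 1 ∧ i ≠ m ∧ ¬p 2 < P 1 m 2 ∧ p 0 < P 2 1 0) ∨
      (b = 2 ∧ i ≠ 1 ∧ ¬p 0 < P 2 1 0 ∧ ¬p 1 < P 0 m 1) := by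
    intro b i hi h
    rcases fin_three_cases 0 b with rfl | rfl | rfl
    · have e1 := h 1 (by decide)
      have e2 := h 2 (by decide)
      exact Or.inl ⟨rfl, fun h => e1.1 (by rw [h]; rfl), e1.2.2 (hX i hi e1.1), e2.2.2 (hX' i hi)⟩
    · have e1 := h 2 (by decide)
      have e2 := h 0 (by decide)
      exact Or.inr (Or.inl ⟨rfl, fun h => e1.1 (by rw [h]; rfl),
        fun h => (hY i hi e1.1).not_gt (e1.2.1 h), e2.2.2 (hY' i hi)⟩)
    · have e1 := h 0 (by decide)
      have e2 := h 1 (by decide)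
      exact Or.inr (Or.inr ⟨rfl, fun h => e1.1 (by rw [h]; rfl),
        fun h => (hZ i hi e1.1).not_gt (e1.2.1 h), fun h => (hZ' i hi).not_gt (e2.2.1 h)⟩)
  by_cases c1 : p 1 < P 0 m 1 ∧ p 2 < P 1 m 2
  · refine hbound 0 m hm' fun b i hi h => ?_
    have := hsigns b i hi h
    tauto
  · by_cases c2 : ¬p 2 < P 1 m 2 ∧ p 0 < P 2 1 0
    · refine hbound 1 m hm' fun b i hi h => ?_
      have := hsigns b i hi h
      tauto
    · refine hbound 2 1 h1 fun b i hi h => ?_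
      have := hsigns b i hi h
      tauto

theorem exists_cellsMeetAtMost_zero {P : Fin 3 → ℕ → Space} (hP : IsBundleFamily 2 P) :
    ∃ H, IsPlaneTriple H ∧ CellsMeetAtMost H (bundleLines 2 P) 0 := by
  -- This normal is orthogonal to the axis `a` and to `P a 2 - P a 1`, so the plane through `P a 1`
  -- contains both lines of the bundle.
  let ν : Fin 3 → Space := fun a =>
    EuclideanSpace.single (a + 1) (P a 2 (a + 2) - P a 1 (a + 2)) -
      EuclideanSpace.single (a + 2) (P a 2 (a + 1) - P a 1 (a + 1))
  have hD : ∀ a d, d ≠ a → P a 2 d - P a 1 d ≠ 0 := fun a d hd =>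
    sub_ne_zero.2 (hP.apply_ne_of_lt hd (by decide) (by decide) (by decide)).symm
  have h0 : ∀ a, ν a a = 0 := by
    intro a
    simp [ν]
  have h1 : ∀ a, ν a (a + 1) ≠ 0 := by
    intro a
    have : a + 2 ≠ a + 1 := by revert a; decide
    simpa [ν] using hD a (a + 2) (fin_three_add_two_ne a)
  have h2 : ∀ a, ν a (a + 2) ≠ 0 := by
    intro a
    have : a + 2 ≠ a + 1 := by revert a; decide
    simpa [ν, this, sub_eq_zero] using (sub_ne_zero.1 (hD a (a + 1) (fin_three_add_one_ne a))).symm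
  have hν : ∀ a, ν a ≠ 0 := fun a h => h1 a (by rw [h]; rfl)
  refine ⟨_, isPlaneTriple_range (c := fun a => inner ℝ (ν a) (P a 1)) hν ?_, ?_⟩
  · intro a j hja
    rcases fin_three_cases j a with rfl | rfl | rfl
    · exact absurd rfl hja
    · simp [h0, h1]
    · simp [h0, h2]
  · rintro _ ⟨p, -, rfl⟩
    rw [Nat.cast_zero, nonpos_iff_eq_zero, Set.encard_eq_zero, Set.eq_empty_iff_forall_notMem]
    rintro _ ⟨⟨a, i, hi, rfl⟩, q, hq, hs⟩
    refine (hs _ ⟨a, rfl⟩).2.2 ((axisLine_le_levelPlane (hν a)).2 ⟨h0 a, ?_⟩ hq)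
    rw [height, ← inner_sub_right]
    have hi' : i = 1 ∨ i = 2 := by
      rw [Finset.mem_Icc] at hi
      omega
    rcases hi' with rfl | rfl
    · simp
    · rw [inner_sub_left, EuclideanSpace.inner_single_left, EuclideanSpace.inner_single_left]
      simp
      ring

/-! ### The three-bundle configuration -/

/-- The points through which the lines of the shifted three-bundle configuration pass. -/
noncomputable def basePoint (m : ℕ) (u v w : ℕ → Space) : Fin 3 → ℕ → Space :=
  ![fun i => !₂[0, (i : ℝ), (i : ℝ)] + u i,
    fun i => !₂[(i : ℝ), 0, 2 * (m : ℝ) + 1 - (i : ℝ)] + v i,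
    fun i => !₂[((m + i : ℕ) : ℝ), ((m + i : ℕ) : ℝ), 0] + w (m + i)]

theorem threeBundles_eq (n : ℕ) (u v w : ℕ → Space) :
    threeBundles n u v w = bundleLines (n / 3) (basePoint (n / 3) u v w) := by
  ext l
  constructor
  · rintro ((⟨i, h1, h2, rfl⟩ | ⟨i, h1, h2, rfl⟩) | ⟨i, h1, h2, rfl⟩)
    · exact ⟨0, i, Finset.mem_Icc.2 ⟨h1, h2⟩, rfl⟩
    · exact ⟨1, i, Finset.mem_Icc.2 ⟨h1, h2⟩, rfl⟩
    · obtain ⟨j, rfl⟩ := Nat.exists_eq_add_of_lt h1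
      refine ⟨2, j + 1, Finset.mem_Icc.2 ⟨by omega, by omega⟩, rfl⟩
  · rintro ⟨a, i, hi, rfl⟩
    rw [Finset.mem_Icc] at hi
    fin_cases a
    · exact Or.inl (Or.inl ⟨i, hi.1, hi.2, rfl⟩)
    · exact Or.inl (Or.inr ⟨i, hi.1, hi.2, rfl⟩)
    · exact Or.inr ⟨n / 3 + i, by omega, by omega, rfl⟩

/-- Before shifting, consecutive lines of a bundle differ by one in each relevant coordinate, and
two bundles leave the gap from `m` to `m + 1` between them. Shifts below 1/4 preserve the order and
stay clear of `m + 1 / 2`. -/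
theorem isBundleFamily_basePoint (m : ℕ) {u v w : ℕ → Space}
    (h : ∀ i, ‖u i‖ < 1 / 4 ∧ ‖v i‖ < 1 / 4 ∧ ‖w i‖ < 1 / 4) :
    IsBundleFamily m (basePoint m u v w) := by
  have hcoord : ∀ {x : Space}, ‖x‖ < 1 / 4 → ∀ d, -(1 / 4) < x d ∧ x d < 1 / 4 := fun {x} hx d =>
    abs_lt.1 (lt_of_le_of_lt (PiLp.norm_apply_le x d) hx)
  have hu := fun i => hcoord (h i).1
  have hv := fun i => hcoord (h i).2.1
  have hw := fun i => hcoord (h i).2.2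
  have hI : ∀ {i : ℕ}, i ∈ Finset.Icc 1 m → (1 : ℝ) ≤ i ∧ (i : ℝ) ≤ m := fun hi => by
    rw [Finset.mem_Icc] at hi
    exact_mod_cast hi
  constructor
  · intro a b c hab hca hcb i hi
    have := hI hi
    have u1 := hu i 1
    have u2 := hu i 2
    have v0 := hv i 0
    fin_cases a <;> fin_cases b <;> simp at hab <;> fin_cases c <;> simp at hca hcb <;>
      simp [basePoint] <;> linarith
  · intro a b c hab hca hcb i hi
    have := hI hi
    have v2 := hv i 2
    have w0 := hw (m + i) 0
    have w1 := hw (m + i) 1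
    fin_cases a <;> fin_cases b <;> simp at hab <;> fin_cases c <;> simp at hca hcb <;>
      simp [basePoint] <;> linarith
  · intro a b hba hab i j hi hj hij
    have hij' : (i : ℝ) + 1 ≤ j := by exact_mod_cast hij
    have ui := hu i b
    have uj := hu j b
    have vi := hv i b
    have vj := hv j b
    have wi := hw (m + i) b
    have wj := hw (m + j) b
    fin_cases a <;> fin_cases b <;> simp at hba hab <;>
      simp [basePoint] at * <;> linarith
  · intro i j hi hj hij
    have hij' : (i : ℝ) + 1 ≤ j := by exact_mod_cast hij
    have vi := hv i 2
    have vj := hv j 2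
    simp [basePoint]
    linarith

theorem theorem1 (n : ℕ) (hn : 3 ∣ n) :
    ∃ δ : ℝ, 0 < δ ∧ ∀ u v w : ℕ → Space,
      (∀ i, ‖u i‖ < δ ∧ ‖v i‖ < δ ∧ ‖w i‖ < δ) →
      NoThreeCoplanar (threeBundles n u v w) →
        (9 ≤ n →
          GPerpEq (threeBundles n u v w) (n / 3 - 1) ∧
          GParEq (threeBundles n u v w) (n / 3 - 1) ∧
          GEq (threeBundles n u v w) (n / 3 - 1)) ∧
        (n = 6 →
          GPerpEq (threeBundles n u v w) 1 ∧
          GParEq (threeBundles n u v w) 1 ∧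
          GEq (threeBundles n u v w) 0) ∧
        (n = 3 →
          GPerpEq (threeBundles n u v w) 0 ∧
          GParEq (threeBundles n u v w) 0 ∧
          GEq (threeBundles n u v w) 0) := by
  refine ⟨1 / 4, by norm_num, fun u v w h h3 => ?_⟩
  have hP := isBundleFamily_basePoint (n / 3) h
  rw [threeBundles_eq] at h3 ⊢
  generalize basePoint (n / 3) u v w = P at hP h3
  refine ⟨fun h9 => ?_, ?_, ?_⟩
  · obtain ⟨H, hH, hc⟩ := exists_cellsMeetAtMost hP (by omega)
    have hle : ∀ {k : ℕ} {H : Set (AffineSubspace ℝ Space)}, IsPlaneTriple H →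
        CellsMeetAtMost H (bundleLines (n / 3) P) k → n / 3 - 1 ≤ k :=
      le_of_cellsMeetAtMost hP (by omega) h3
    -- The three classes of plane triples are nested: the upper bound comes from the smallest class
    -- and the lower bound from the largest.
    exact ⟨⟨⟨H, hH, hc⟩, fun k ⟨_, hH', hk⟩ => hle hH'.1.1 hk⟩,
      ⟨⟨H, hH.1, hc⟩, fun k ⟨_, hH', hk⟩ => hle hH'.1 hk⟩,
      ⟨⟨H, hH.1.1, hc⟩, fun k ⟨_, hH', hk⟩ => hle hH' hk⟩⟩
  · rintro rfl
    obtain ⟨H, hH, hc⟩ := exists_cellsMeetAtMost hP (by decide)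
    obtain ⟨H₀, hH₀, hc₀⟩ := exists_cellsMeetAtMost_zero hP
    have hle : ∀ {k : ℕ} {H : Set (AffineSubspace ℝ Space)}, IsAxisParallelTriple H →
        CellsMeetAtMost H (bundleLines (6 / 3) P) k → 1 ≤ k :=
      one_le_of_cellsMeetAtMost hP (by decide)
    exact ⟨⟨⟨H, hH, hc⟩, fun k ⟨_, hH', hk⟩ => hle hH'.1 hk⟩,
      ⟨⟨H, hH.1, hc⟩, fun k ⟨_, hH', hk⟩ => hle hH' hk⟩,
      ⟨⟨H₀, hH₀, hc₀⟩, fun k _ => Nat.zero_le k⟩⟩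
  · rintro rfl
    obtain ⟨H, hH, hc⟩ := exists_cellsMeetAtMost hP (by decide)
    exact ⟨⟨⟨H, hH, hc⟩, fun k _ => Nat.zero_le k⟩,
      ⟨⟨H, hH.1, hc⟩, fun k _ => Nat.zero_le k⟩,
      ⟨⟨H, hH.1.1, hc⟩, fun k _ => Nat.zero_le k⟩⟩
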